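/- Let $\mathbb K$ be an algebraically closed field of characteristic zero. Let $\mathbb K\langle x,y\rangle$ be the free associative algebra on two generators. For representations $M,N$ of a Lie algebra $L$ and a class $\mathcal C$ of finite-dimensional representations of $L$, let $\operatorname{Hom}_L(M,N)_{\mathcal C}$ be the space of all homomorphisms $M\to N$ that factor through a finite direct sum of objects of $\mathcal C$, and let $\operatorname{rad}(M,N)$ be the set of all $f\in\operatorname{Hom}_L(M,N)$ such that $1_M-gf$ is invertible for every $g\in\operatorname{Hom}_L(N,M)$. A Lie algebra $L$ over $\mathbb K$ is called controlled wild if there are an $L$-$\mathbb K\langle x,y\rangle$-bimodule $B$ that is free of finite positive rank as a right $\mathbb K\langle x,y\rangle$-module, and a class $\mathcal C$ of finite-dimensional representations of $L$, such that the ($\mathbb K$-linear, exact and faithful) functor $F=B\otimes_{\mathbb K\langle x,y\rangle}-$ from finite-dimensional $\mathbb K\langle x,y\rangle$-modules to finite-dimensional representations of $L$ satisfies, for all finite-dimensional $\mathbb K\langle x,y\rangle$-modules $V,W$, $$\operatorname{Hom}_L(FV,FW)=F\operatorname{Hom}(V,W)\oplus\operatorname{Hom}_L(FV,FW)_{\mathcal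 C},\qquad \operatorname{Hom}_L(FV,FW)_{\mathcal C}\subseteq\operatorname{rad}(FV,FW).$$ Proposition. Every finite-dimensional solvable Lie algebra $L$ over $\mathbb K$ with $\dim L>1$ is controlled wild. -/

import Mathlib

universe u v

attribute [local instance 100] LieRing.ofAssociativeRing

/-- The free associative algebra `K⟨x, y⟩` on two noncommuting generators. -/
abbrev FreeAlg2 (K : Type u) [CommRing K] : Type u := FreeAlgebra K (Fin 2)

/-- The objects of the category of finite-dimensional representations of the Lie algebra `L`.
Up to isomorphism there is no loss in taking their underlying spaces in the universe of `K`. -/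
structure FDLieRep (K : Type u) [Field K] (L : Type v) [LieRing L] [LieAlgebra K L] where
  carrier : Type u
  [addCommGroup : AddCommGroup carrier]
  [module : Module K carrier]
  [lieRingModule : LieRingModule L carrier]
  [lieModule : LieModule K L carrier]
  [finiteDimensional : FiniteDimensional K carrier]

attribute [instance] FDLieRep.addCommGroup FDLieRep.module FDLieRep.lieRingModule
  FDLieRep.lieModule FDLieRep.finiteDimensional

section Morphisms

variable {K : Type u} [Field K] {L : Type v} [LieRing L] [LieAlgebra K L]
  (M N : Type u) [AddCommGroup M] [Module K M] [LieRingModule L M] [LieModule K L M]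
  [AddCommGroup N] [Module K N] [LieRingModule L N] [LieModule K L N]

/-- `Hom(M, N)_C`: the homomorphisms `M → N` which factor through a finite direct sum of
objects of `C`, that is, the finite sums of homomorphisms factoring through an object of `C`. -/
def homThrough (C : Set (FDLieRep K L)) : Submodule K (M →ₗ⁅K,L⁆ N) :=
  Submodule.span K
    {f | ∃ Z ∈ C, ∃ (g : M →ₗ⁅K,L⁆ Z.carrier) (h : Z.carrier →ₗ⁅K,L⁆ N), f = h.comp g}

/-- `rad(M, N)`, the radical of the category of representations: the homomorphisms `f : M → N`
such that `1 - g ∘ f` is invertible for every homomorphism `g : N → M`. -/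
def homRadical : Set (M →ₗ⁅K,L⁆ N) :=
  {f | ∀ g : N →ₗ⁅K,L⁆ M, Function.Bijective ((LieModuleHom.id : M →ₗ⁅K,L⁆ M) - g.comp f)}

end Morphisms

section Family

variable {K : Type u} [Field K] {L : Type v} [LieRing L] [LieAlgebra K L] {n : ℕ}

/-- An `L`-`K⟨x, y⟩`-bimodule `B` which is free of rank `n` as a right `K⟨x, y⟩`-module amounts,
in a basis, to a homomorphism of Lie algebras `ρ` from `L` to the `n × n` matrices over `K⟨x, y⟩`.
For a left `K⟨x, y⟩`-module `V`, this is the representation `B ⊗ V` of `L`: its space is `Vⁿ`, and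
`a ∈ L` acts as the matrix `ρ a`. -/
def BimodTensor (_ρ : L →ₗ⁅K⁆ Matrix (Fin n) (Fin n) (FreeAlg2 K)) (V : Type u) : Type u :=
  Fin n → V

namespace BimodTensor

variable (ρ : L →ₗ⁅K⁆ Matrix (Fin n) (Fin n) (FreeAlg2 K))
  (V W : Type u) [AddCommGroup V] [Module K V] [Module (FreeAlg2 K) V]
  [IsScalarTower K (FreeAlg2 K) V]
  [AddCommGroup W] [Module K W] [Module (FreeAlg2 K) W] [IsScalarTower K (FreeAlg2 K) W]

instance : AddCommGroup (BimodTensor ρ V) := inferInstanceAs (AddCommGroup (Fin n → V))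

instance : Module K (BimodTensor ρ V) := inferInstanceAs (Module K (Fin n → V))

instance [FiniteDimensional K V] : FiniteDimensional K (BimodTensor ρ V) :=
  inferInstanceAs (FiniteDimensional K (Fin n → V))

instance : Bracket L (BimodTensor ρ V) where
  bracket a v := fun i => ∑ j, ρ a i j • v j

instance : LieRingModule L (BimodTensor ρ V) where
  add_lie a b v := by
    funext i
    change ∑ j, ρ (a + b) i j • v j = ∑ j, ρ a i j • v j + ∑ j, ρ b i j • v j
    simp [add_smul, Finset.sum_add_distrib]
  lie_add a v w := by
    funext i
    change ∑ j, ρ a i j • (v j + w j) = ∑ j, ρ a i j • v j + ∑ j, ρ a i j • w j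
    simp [smul_add, Finset.sum_add_distrib]
  leibniz_lie a b v := by
    funext i
    change ∑ j, ρ a i j • (∑ k, ρ b j k • v k) =
      ∑ j, ρ ⁅a, b⁆ i j • v j + ∑ j, ρ b i j • (∑ k, ρ a j k • v k)
    have key : ∀ P Q : Matrix (Fin n) (Fin n) (FreeAlg2 K),
        ∑ j, P i j • (∑ k, Q j k • v k) = ∑ k, (P * Q) i k • v k := by
      intro P Q
      simp only [Finset.smul_sum, Matrix.mul_apply, Finset.sum_smul, smul_smul]
      exact Finset.sum_comm
    rw [key, key, LieHom.map_lie, Ring.lie_def, ← Finset.sum_add_distrib]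
    refine Finset.sum_congr rfl fun k _ => ?_
    rw [← add_smul, Matrix.sub_apply, sub_add_cancel]

instance : LieModule K L (BimodTensor ρ V) where
  smul_lie c a v := by
    funext i
    change ∑ j, ρ (c • a) i j • v j = c • ∑ j, ρ a i j • v j
    simp [Finset.smul_sum]
  lie_smul c a v := by
    funext i
    change ∑ j, ρ a i j • (c • v j) = c • ∑ j, ρ a i j • v j
    rw [Finset.smul_sum]
    exact Finset.sum_congr rfl fun j _ => smul_comm _ _ _

/-- The functor `B ⊗ -` on homomorphisms: `f : V → W` is sent to `fⁿ : Vⁿ → Wⁿ`. -/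
def map : (V →ₗ[FreeAlg2 K] W) →ₗ[K] (BimodTensor ρ V →ₗ⁅K,L⁆ BimodTensor ρ W) where
  toFun f :=
    { toFun := fun v i => f (v i)
      map_add' := fun v w => funext fun i => map_add f (v i) (w i)
      map_smul' := fun c v => funext fun i => LinearMap.map_smul_of_tower f c (v i)
      map_lie' := by
        intro a v
        funext i
        change f (∑ j, ρ a i j • v j) = ∑ j, ρ a i j • f (v j)
        simp }
  map_add' _ _ := rfl
  map_smul' _ _ := rfl

end BimodTensor

end Family

/-- The Lie algebra `L` is controlled wild: there are a bimodule `B`, free of positive finite rank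
over `K⟨x, y⟩` (so that `B ⊗ -` is an exact faithful `K`-linear functor from the finite-dimensional
`K⟨x, y⟩`-modules to the finite-dimensional representations of `L`), and a class `C` of
finite-dimensional representations of `L`, the control class, such that
`Hom(B ⊗ V, B ⊗ W) = (B ⊗ Hom(V, W)) ⊕ Hom(B ⊗ V, B ⊗ W)_C` and
`Hom(B ⊗ V, B ⊗ W)_C ⊆ rad(B ⊗ V, B ⊗ W)` for all finite-dimensional `V` and `W`. -/
def IsControlledWild (K : Type u) [Field K] (L : Type v) [LieRing L] [LieAlgebra K L] : Prop :=
  ∃ (n : ℕ) (_ : 0 < n) (ρ : L →ₗ⁅K⁆ Matrix (Fin n) (Fin n) (FreeAlg2 K))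
    (C : Set (FDLieRep K L)),
    ∀ (V W : Type u) [AddCommGroup V] [Module K V] [Module (FreeAlg2 K) V]
      [IsScalarTower K (FreeAlg2 K) V] [FiniteDimensional K V]
      [AddCommGroup W] [Module K W] [Module (FreeAlg2 K) W]
      [IsScalarTower K (FreeAlg2 K) W] [FiniteDimensional K W],
      IsCompl (LinearMap.range (BimodTensor.map ρ V W))
        (homThrough (BimodTensor ρ V) (BimodTensor ρ W) C) ∧
      (homThrough (BimodTensor ρ V) (BimodTensor ρ W) C :
          Set (BimodTensor ρ V →ₗ⁅K,L⁆ BimodTensor ρ W)) ⊆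
        homRadical (BimodTensor ρ V) (BimodTensor ρ W)

/-! A solvable `L` with `dim L > 1` maps onto a two-dimensional Lie algebra with basis `a`, `b` and
`⁅a, b⁆ = 0` or `⁅a, b⁆ = b`, by Lie's theorem applied to the adjoint representation and then to an
ideal of codimension one (`exists_isPlaneQuotient`). It is therefore enough to construct a bimodule
over each of these two algebras.

The control class consists of the representations annihilated by a set `S` of noncommutative
polynomials in `L`. A homomorphism lies in the control part iff `S` kills its image, so the whole
claim becomes a computation with the operators in `S` (`isControlledWild_of_words`). They are chosen
to carry the generators of the bimodule to its socle and to kill the other basis vectors. A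
homomorphism commutes with them, so its diagonal components on generators determine its restriction
to the socle, and the relations there force these components to be one `K⟨x, y⟩`-linear map.

In the abelian case there is one generator and `a²`, `ab`, `b²` act from top to socle as `1`, `x`,
`y`. In the nonabelian case five generators of weights `0, …, 4` give five subspaces of a socle
`V²`: the two axes, the diagonal, and the graphs of `x` and `y`. A pair of maps respecting these is
a single map commuting with `x` and `y`.

The control part is radical because a homomorphism killed by `S` has no component on generators,
while one-dimensional quotients see only generators. -/

/-! ### Control classes defined by noncommutative polynomials. -/

section WordAction

variable {K : Type u} [Field K] {L : Type v} [LieRing L] [LieAlgebra K L]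

/-- The action of the noncommutative polynomials in the elements of `L` on a representation. -/
noncomputable def wordAction (K : Type u) [Field K] (L : Type v) [LieRing L] [LieAlgebra K L]
    (M : Type*) [AddCommGroup M] [Module K M] [LieRingModule L M] [LieModule K L M] :
    FreeAlgebra K L →ₐ[K] Module.End K M :=
  FreeAlgebra.lift K fun z => LieModule.toEnd K L M z

section

variable {M N : Type*} [AddCommGroup M] [Module K M] [LieRingModule L M] [LieModule K L M]
  [AddCommGroup N] [Module K N] [LieRingModule L N] [LieModule K L N]

@[simp]
theorem wordAction_ι (z : L) (m : M) : wordAction K L M (FreeAlgebra.ι K z) m = ⁅z, m⁆ := by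
  simp [wordAction]

theorem LieModuleHom.map_wordAction (f : M →ₗ⁅K,L⁆ N) (p : FreeAlgebra K L) (m : M) :
    f (wordAction K L M p m) = wordAction K L N p (f m) := by
  induction p using FreeAlgebra.induction generalizing m with
  | grade0 r => simp [Algebra.algebraMap_eq_smul_one]
  | grade1 z => simp
  | mul p q hp hq => simp [hp, hq]
  | add p q hp hq => simp [hp, hq]

end

/-- The representations annihilated by a set of noncommutative polynomials. -/
def annihilatedBy (S : Set (FreeAlgebra K L)) : Set (FDLieRep K L) :=
  {Z | ∀ p ∈ S, ∀ z : Z.carrier, wordAction K L Z.carrier p z = 0}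

/-- The class is closed under subrepresentations and the killed maps form a subspace, so the image
of `f` alone serves as the intermediate object. -/
theorem mem_homThrough_annihilatedBy {M N : Type u} [AddCommGroup M] [Module K M]
    [LieRingModule L M] [LieModule K L M] [AddCommGroup N] [Module K N] [LieRingModule L N]
    [LieModule K L N] [FiniteDimensional K N] {S : Set (FreeAlgebra K L)} {f : M →ₗ⁅K,L⁆ N} :
    f ∈ homThrough M N (annihilatedBy S) ↔ ∀ p ∈ S, ∀ m, wordAction K L N p (f m) = 0 := by
  constructor
  · intro hf
    induction hf using Submodule.span_induction with
    | mem f hf =>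
      obtain ⟨Z, hZ, g, h, rfl⟩ := hf
      intro p hp m
      simp only [LieModuleHom.comp_apply]
      rw [← LieModuleHom.map_wordAction, hZ p hp, map_zero]
    | zero => simp
    | add f g _ _ hf hg =>
      intro p hp m
      simp [hf p hp, hg p hp]
    | smul c f _ hf =>
      intro p hp m
      simp [hf p hp]
  · intro hf
    refine Submodule.subset_span ⟨⟨f.range⟩, ?_,
      f.codRestrict f.range fun m => ⟨m, rfl⟩, f.range.incl, ?_⟩
    · rintro p hp ⟨_, m, rfl⟩
      apply Subtype.ext
      have := LieModuleHom.map_wordAction f.range.incl p ⟨f m, m, rfl⟩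
      exact this.trans (hf p hp m)
    · ext m
      rfl

end WordAction

/-! ### A criterion for controlled wildness. -/

section Criterion

variable {K : Type u} [Field K] {L : Type v} [LieRing L] [LieAlgebra K L]

/-- The dual form of Lie's theorem. -/
theorem exists_semiinvariant_functional [IsAlgClosed K] [CharZero K] [LieAlgebra.IsSolvable L]
    (M : Type*) [AddCommGroup M] [Module K M] [LieRingModule L M] [LieModule K L M]
    [FiniteDimensional K M] [Nontrivial M] :
    ∃ (ψ : M →ₗ[K] K) (χ : L →ₗ[K] K), ψ ≠ 0 ∧ ∀ z m, ψ ⁅z, m⁆ = χ z * ψ m := by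
  obtain ⟨χ, _⟩ := LieModule.exists_nontrivial_weightSpace_of_isSolvable K L (Module.Dual K M)
  obtain ⟨⟨ψ, hψχ⟩, hψ0⟩ := exists_ne (0 : LieModule.weightSpace (Module.Dual K M) χ)
  rw [LieModule.mem_weightSpace] at hψχ
  refine ⟨ψ, -χ, fun h => hψ0 (Subtype.ext h), fun z m => ?_⟩
  have := LinearMap.congr_fun (hψχ z) m
  rw [Module.Dual.lie_apply, LinearMap.smul_apply, smul_eq_mul] at this
  rw [LinearMap.neg_apply, neg_mul, ← this, neg_neg]

/-- If `1 - h` were not onto, its cokernel would carry a nonzero semi-invariant functional `ψ`; then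
`ψ = ψ ∘ h = 0` on the whole space. Bijectivity follows by finite dimension. -/
theorem bijective_id_sub_of_semiinvariants_vanish [IsAlgClosed K] [CharZero K]
    [LieAlgebra.IsSolvable L]
    {M : Type*} [AddCommGroup M] [Module K M] [LieRingModule L M] [LieModule K L M]
    [FiniteDimensional K M] (h : M →ₗ⁅K,L⁆ M)
    (hψ : ∀ (ψ : M →ₗ[K] K) (χ : L → K), (∀ z m, ψ ⁅z, m⁆ = χ z * ψ m) → ∀ m, ψ (h m) = 0) :
    Function.Bijective (LieModuleHom.id - h : M →ₗ⁅K,L⁆ M) := by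
  set g : M →ₗ⁅K,L⁆ M := LieModuleHom.id - h
  have hsurj : Function.Surjective g := by
    rw [← LieModuleHom.range_eq_top]
    by_contra htop
    have : Nontrivial (M ⧸ g.range) :=
      Submodule.Quotient.nontrivial_iff.2 fun h => htop ((LieSubmodule.toSubmodule_eq_top _).1 h)
    obtain ⟨ψ, χ, hψ0, hχ⟩ := exists_semiinvariant_functional (K := K) (L := L) (M ⧸ g.range)
    refine hψ0 (LinearMap.ext fun q => ?_)
    obtain ⟨m, rfl⟩ := LieSubmodule.Quotient.surjective_mk' g.range q
    let π : M →ₗ⁅K,L⁆ M ⧸ g.range := LieSubmodule.Quotient.mk' g.range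
    have hh : ψ (π (h m)) = 0 :=
      hψ (ψ ∘ₗ (π : M →ₗ[K] M ⧸ g.range)) χ (fun z m => hχ z (π m)) m
    have hg0 : π (g m) = 0 := (LieSubmodule.Quotient.mk_eq_zero _).2 ⟨m, rfl⟩
    have hgm : g m = m - h m := rfl
    rw [hgm, map_sub, sub_eq_zero] at hg0
    exact (congrArg ψ hg0).trans hh
  exact ⟨(LinearMap.injective_iff_surjective (f := (g : M →ₗ[K] M))).2 hsurj, hsurj⟩

variable {n : ℕ}

/-- With the control class `annihilatedBy S`, `hlift` makes the two summands span, `hfaithful` makes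
them independent, and `hrad` places the control part in the radical. -/
theorem isControlledWild_of_words [IsAlgClosed K] [CharZero K] [LieAlgebra.IsSolvable L]
    (hn : 0 < n) (ρ : L →ₗ⁅K⁆ Matrix (Fin n) (Fin n) (FreeAlg2 K)) (S : Set (FreeAlgebra K L))
    (hlift : ∀ (V W : Type u) [AddCommGroup V] [Module K V] [Module (FreeAlg2 K) V]
      [IsScalarTower K (FreeAlg2 K) V] [AddCommGroup W] [Module K W] [Module (FreeAlg2 K) W]
      [IsScalarTower K (FreeAlg2 K) W] (f : BimodTensor ρ V →ₗ⁅K,L⁆ BimodTensor ρ W),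
      ∃ φ : V →ₗ[FreeAlg2 K] W, ∀ p ∈ S, ∀ v, wordAction K L (BimodTensor ρ W) p (f v) =
        wordAction K L (BimodTensor ρ W) p (BimodTensor.map ρ V W φ v))
    (hfaithful : ∀ (V W : Type u) [AddCommGroup V] [Module K V] [Module (FreeAlg2 K) V]
      [IsScalarTower K (FreeAlg2 K) V] [AddCommGroup W] [Module K W] [Module (FreeAlg2 K) W]
      [IsScalarTower K (FreeAlg2 K) W] (φ : V →ₗ[FreeAlg2 K] W),
      (∀ p ∈ S, ∀ v, wordAction K L (BimodTensor ρ W) p (BimodTensor.map ρ V W φ v) = 0) → φ = 0)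
    (hrad : ∀ (V : Type u) [AddCommGroup V] [Module K V] [Module (FreeAlg2 K) V]
      [IsScalarTower K (FreeAlg2 K) V] (ψ : BimodTensor ρ V →ₗ[K] K) (χ : L → K),
      (∀ z v, ψ ⁅z, v⁆ = χ z * ψ v) →
      ∀ v, (∀ p ∈ S, wordAction K L (BimodTensor ρ V) p v = 0) → ψ v = 0) :
    IsControlledWild K L := by
  refine ⟨n, hn, ρ, annihilatedBy S, ?_⟩
  intro V W _ _ _ _ _ _ _ _ _ _
  refine ⟨IsCompl.of_le ?_ ?_, ?_⟩
  · rintro _ ⟨⟨φ, rfl⟩, hφ⟩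
    rw [SetLike.mem_coe, mem_homThrough_annihilatedBy] at hφ
    rw [hfaithful V W φ hφ, map_zero]
    exact zero_mem _
  · intro f _
    obtain ⟨φ, hφ⟩ := hlift V W f
    rw [← add_sub_cancel (BimodTensor.map ρ V W φ) f]
    refine Submodule.add_mem_sup ⟨φ, rfl⟩ (mem_homThrough_annihilatedBy.2 fun p hp v => ?_)
    rw [LieModuleHom.sub_apply, map_sub, hφ p hp, sub_self]
  · intro f hf g
    rw [SetLike.mem_coe, mem_homThrough_annihilatedBy] at hf
    refine bijective_id_sub_of_semiinvariants_vanish _ fun ψ χ hψ m =>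
      hrad V ψ χ hψ _ fun p hp => ?_
    rw [LieModuleHom.comp_apply, ← LieModuleHom.map_wordAction, hf p hp, map_zero]

end Criterion

/-! ### Two-dimensional quotients of solvable Lie algebras. -/

section Quotient

variable {K : Type u} [Field K] {L : Type v} [LieRing L] [LieAlgebra K L]

/-- Functionals `α`, `β` on `L` which are the coordinates of a surjection from `L` onto the
two-dimensional Lie algebra with basis `a`, `b` and bracket `⁅a, b⁆ = ε b`. -/
structure IsPlaneQuotient (ε : K) (α β : L →ₗ[K] K) : Prop where
  fst_lie : ∀ z w : L, α ⁅z, w⁆ = 0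
  snd_lie : ∀ z w : L, β ⁅z, w⁆ = ε * (α z * β w - α w * β z)
  exists_fst : ∃ a, α a = 1 ∧ β a = 0
  exists_snd : ∃ b, α b = 0 ∧ β b = 1

/-- The homomorphism to an associative algebra given by a surjection onto a two-dimensional Lie
algebra and the images of the basis. -/
def IsPlaneQuotient.toLieHom {ε : K} {α β : L →ₗ[K] K} (h : IsPlaneQuotient ε α β) {R : Type*}
    [Ring R] [Algebra K R] (A B : R) (hAB : A * B - B * A = ε • B) : L →ₗ⁅K⁆ R :=
  { α.smulRight A + β.smulRight B with
    map_lie' := by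
      intro z w
      have hBA : A * B = ε • B + B * A := sub_eq_iff_eq_add.1 hAB
      simp only [AddHom.toFun_eq_coe, LinearMap.coe_toAddHom, LinearMap.add_apply,
        LinearMap.smulRight_apply, h.fst_lie, h.snd_lie, Ring.lie_def, mul_add, add_mul, smul_mul_smul_comm, hBA]
      module }

theorem IsPlaneQuotient.toLieHom_apply {ε : K} {α β : L →ₗ[K] K} (h : IsPlaneQuotient ε α β)
    {R : Type*} [Ring R] [Algebra K R] (A B : R) (hAB : A * B - B * A = ε • B) (z : L) :
    h.toLieHom A B hAB z = α z • A + β z • B := rfl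

/-- A semi-invariant functional of the adjoint representation has trivial character: this follows
from `⁅a, a⁆ = 0` and antisymmetry, evaluated at some `a` with `α a ≠ 0`. -/
theorem exists_functional_lie_eq_zero [IsAlgClosed K] [CharZero K] [LieAlgebra.IsSolvable L]
    [FiniteDimensional K L] [Nontrivial L] : ∃ α : L →ₗ[K] K, α ≠ 0 ∧ ∀ z w : L, α ⁅z, w⁆ = 0 := by
  obtain ⟨α, χ, hα, hχ⟩ := exists_semiinvariant_functional (K := K) (L := L) L
  refine ⟨α, hα, fun z w => ?_⟩
  obtain ⟨a, ha⟩ : ∃ a, α a ≠ 0 := by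
    by_contra! h
    exact hα (LinearMap.ext h)
  have haz : χ a = 0 := by
    have := hχ a a
    rw [lie_self, map_zero] at this
    exact (mul_eq_zero.1 this.symm).resolve_right ha
  have hz : χ z = 0 := by
    have := hχ z a
    rw [← lie_skew, map_neg, hχ, haz, zero_mul, neg_zero] at this
    exact (mul_eq_zero.1 this.symm).resolve_right ha
  rw [hχ, hz, zero_mul]

/-- A semi-invariant functional `β₀` on the ideal `J = ker α` has a character that vanishes on `J`,
so `ker β₀` is an ideal of codimension two in `L`, and in the quotient `⁅a, b⁆ = χ(a) b`. -/
theorem exists_isPlaneQuotient [IsAlgClosed K] [CharZero K] [LieAlgebra.IsSolvable L]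
    [FiniteDimensional K L] (hdim : 1 < Module.finrank K L) :
    ∃ α β : L →ₗ[K] K, IsPlaneQuotient 0 α β ∨ IsPlaneQuotient 1 α β := by
  have : Nontrivial L := Module.nontrivial_of_finrank_pos (R := K) (zero_lt_one.trans hdim)
  obtain ⟨α, hα, hαlie⟩ := exists_functional_lie_eq_zero (K := K) (L := L)
  obtain ⟨a, ha⟩ : ∃ a, α a = 1 := LinearMap.surjective hα 1
  let J : LieIdeal K L := { LinearMap.ker α with lie_mem := fun {z w} _ => hαlie z w }
  have hJ : ∀ z, z ∈ J ↔ α z = 0 := fun z => LinearMap.mem_ker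
  have : Nontrivial J := by
    change Nontrivial (LinearMap.ker α)
    refine Module.nontrivial_of_finrank_pos (R := K) ?_
    have := LinearMap.finrank_range_add_finrank_ker α
    have := (LinearMap.range α).finrank_le
    rw [Module.finrank_self] at this
    omega
  obtain ⟨β₀, χ, hβ₀, hχ⟩ := exists_semiinvariant_functional (K := K) (L := L) J
  obtain ⟨b, hb⟩ : ∃ b, β₀ b = 1 := LinearMap.surjective hβ₀ 1
  have hχb : χ b = 0 := by
    have := hχ b b
    rwa [hb, mul_one, show ⁅(b : L), b⁆ = 0 from Subtype.ext (lie_self (b : L)), map_zero,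
      eq_comm] at this
  have hχJ : ∀ j : J, χ j = 0 := fun j => by
    have h1 := hχ j b
    have h2 := hχ b j
    rw [show ⁅(j : L), b⁆ = -⁅(b : L), j⁆ from Subtype.ext (lie_skew (j : L) (b : L)).symm, map_neg,
      h2, hχb, hb, zero_mul, neg_zero, mul_one] at h1
    exact h1.symm
  -- The projection onto `J` along `a`; it extends `β₀` to `L`.
  let r : L →ₗ[K] J := LinearMap.codRestrict J.toSubmodule (LinearMap.id - α.smulRight a) fun z => by
    change α _ = 0
    simp [ha]
  have hr : ∀ z, z = α z • a + (r z : L) := fun z => (add_sub_cancel (α z • a) z).symm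
  have hrJ : ∀ j : J, r j = j := fun j => by
    have := hr j
    rw [(hJ j).1 j.2, zero_smul, zero_add] at this
    exact Subtype.ext this.symm
  have hra : r a = 0 := by
    have := hr a
    rw [ha, one_smul, left_eq_add] at this
    exact Subtype.ext this
  have hχα : ∀ z, χ z = α z * χ a := fun z => by
    conv_lhs => rw [hr z]
    rw [map_add, map_smul, hχJ, add_zero, smul_eq_mul]
  have hlie : ∀ z w, r ⁅z, w⁆ = α z • ⁅a, r w⁆ - α w • ⁅a, r z⁆ + ⁅(r z : L), r w⁆ := fun z w => by
    apply Subtype.ext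
    have h0 := hr ⁅z, w⁆
    rw [hαlie, zero_smul, zero_add] at h0
    rw [← h0]
    conv_lhs => rw [hr z, hr w]
    have := lie_skew (r z : L) a
    simp only [lie_add, add_lie, lie_smul, smul_lie, lie_self, smul_zero, zero_add,
      LieSubmodule.coe_add, LieSubmodule.coe_sub, LieSubmodule.coe_smul, LieSubmodule.coe_bracket,
      ← this]
    module
  have hβlie : ∀ z w, β₀ (r ⁅z, w⁆) = χ a * (α z * β₀ (r w) - α w * β₀ (r z)) := fun z w => by
    rw [hlie, map_add, map_sub, map_smul, map_smul, hχ, hχ, hχ, hχJ]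
    simp only [smul_eq_mul]
    ring
  have hαb : α b = 0 := (hJ b).1 b.2
  by_cases hc : χ a = 0
  · refine ⟨α, β₀ ∘ₗ r, Or.inl ⟨hαlie, fun z w => ?_, ⟨a, ha, ?_⟩, ⟨b, hαb, ?_⟩⟩⟩
    · simp [hβlie, hc]
    · simp [hra]
    · simp [hrJ, hb]
  -- Dividing `a` by its eigenvalue `χ a` normalises the bracket to `⁅a, b⁆ = b`.
  · refine ⟨χ a • α, β₀ ∘ₗ r, Or.inr ⟨fun z w => ?_, fun z w => ?_, ⟨(χ a)⁻¹ • a, ?_, ?_⟩,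
      ⟨b, ?_, ?_⟩⟩⟩
    · simp [hαlie]
    · simp [hβlie]
      ring
    · simp [ha, hc]
    · simp [hra]
    · simp [hαb]
    · simp [hrJ, hb]

end Quotient

/-! ### Calculus in `B ⊗ V` by columns. -/

section Column

variable {K : Type u} [Field K]

/-- A `K`-linear map commuting with both generators is linear over the free algebra. -/
def LinearMap.toFreeAlg2 {V W : Type*} [AddCommGroup V] [Module K V] [Module (FreeAlg2 K) V]
    [IsScalarTower K (FreeAlg2 K) V] [AddCommGroup W] [Module K W] [Module (FreeAlg2 K) W]
    [IsScalarTower K (FreeAlg2 K) W] (φ : V →ₗ[K] W)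
    (hφ : ∀ (i : Fin 2) (v : V), φ (FreeAlgebra.ι K i • v) = FreeAlgebra.ι K i • φ v) :
    V →ₗ[FreeAlg2 K] W :=
  { φ with
    map_smul' := by
      intro r v
      change φ (r • v) = r • φ v
      induction r using FreeAlgebra.induction generalizing v with
      | grade0 c => simp [Algebra.algebraMap_eq_smul_one]
      | grade1 i => exact hφ i v
      | mul p q hp hq => rw [mul_smul, mul_smul, hp, hq]
      | add p q hp hq => rw [add_smul, add_smul, map_add, hp, hq] }

variable {L : Type v} [LieRing L] [LieAlgebra K L] {n : ℕ}
  (ρ : L →ₗ⁅K⁆ Matrix (Fin n) (Fin n) (FreeAlg2 K))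

namespace BimodTensor

variable {V W : Type u} [AddCommGroup V] [Module K V]

/-- The coordinates of a vector of `B ⊗ V`. -/
def coord (p : Fin n) : BimodTensor ρ V →ₗ[K] V where
  toFun v := v p
  map_add' _ _ := rfl
  map_smul' _ _ := rfl

theorem ext_coord {v w : BimodTensor ρ V} (h : ∀ p, coord ρ p v = coord ρ p w) : v = w :=
  funext h

variable [Module (FreeAlg2 K) V]
  [IsScalarTower K (FreeAlg2 K) V]
  [AddCommGroup W] [Module K W] [Module (FreeAlg2 K) W] [IsScalarTower K (FreeAlg2 K) W]

/-- The tensor of an element of the bimodule, given by its column of coordinates, with a vector. -/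
def tmul (c : Fin n → FreeAlg2 K) : V →ₗ[K] BimodTensor ρ V where
  toFun u := fun p => c p • u
  map_add' u w := funext fun p => smul_add (c p) u w
  map_smul' k u := funext fun p => smul_comm (c p) k u

@[simp]
theorem coord_tmul (p : Fin n) (c : Fin n → FreeAlg2 K) (u : V) :
    coord ρ p (tmul ρ c u) = c p • u := rfl

theorem lie_tmul (z : L) (c : Fin n → FreeAlg2 K) (u : V) :
    ⁅z, tmul ρ c u⁆ = tmul ρ (Matrix.mulVec (ρ z) c) u := by
  funext p
  change ∑ q, ρ z p q • c q • u = (∑ q, ρ z p q * c q) • u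
  simp [Finset.sum_smul, mul_smul]

@[simp]
theorem zero_tmul (u : V) : tmul ρ (0 : Fin n → FreeAlg2 K) u = 0 :=
  funext fun _ => zero_smul _ _

theorem add_tmul (c d : Fin n → FreeAlg2 K) (u : V) :
    tmul ρ (c + d) u = tmul ρ c u + tmul ρ d u :=
  funext fun _ => add_smul _ _ _

theorem smul_tmul (k : K) (c : Fin n → FreeAlg2 K) (u : V) :
    tmul ρ (k • c) u = k • tmul ρ c u :=
  funext fun p => smul_assoc k (c p) u

/-- The tensor of a basis element of the bimodule with a vector. -/
abbrev single (p : Fin n) : V →ₗ[K] BimodTensor ρ V := tmul ρ (Pi.single p 1)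

theorem single_tmul (p : Fin n) (r : FreeAlg2 K) (u : V) :
    tmul ρ (Pi.single p r) u = tmul ρ (Pi.single p 1) (r • u) := by
  funext q
  change Pi.single (M := fun _ => FreeAlg2 K) p r q • u =
    Pi.single (M := fun _ => FreeAlg2 K) p 1 q • r • u
  rcases eq_or_ne q p with rfl | h
  · simp
  · simp [h]

theorem coord_map (φ : V →ₗ[FreeAlg2 K] W) (p : Fin n) (v : BimodTensor ρ V) :
    coord ρ p (map ρ V W φ v) = φ (coord ρ p v) := rfl

theorem sum_single_coord (v : BimodTensor ρ V) :
    ∑ p, single ρ p (coord ρ p v) = v := by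
  refine ext_coord ρ fun q => ?_
  rw [map_sum, Finset.sum_eq_single q]
  · simp
  · intro p _ hp
    simp [hp.symm]
  · simp

theorem induction_on {motive : BimodTensor ρ V → Prop} (v : BimodTensor ρ V)
    (add : ∀ v w, motive v → motive w → motive (v + w)) (zero : motive 0)
    (single : ∀ p u, motive (single ρ p u)) : motive v := by
  rw [← sum_single_coord ρ v]
  exact Finset.sum_induction _ motive add zero fun p _ => single p _

end BimodTensor

end Column

/-! ### The abelian quotient. -/

section Abelian

variable (K : Type u) [Field K]

/-- The first of two commuting matrices acting on four copies of a `K⟨x, y⟩`-module. -/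
def abelianFst : Matrix (Fin 4) (Fin 4) (FreeAlg2 K) :=
  !![0, 0, 0, 0; 1, 0, 0, 0; 0, 0, 0, 0; 0, 1, FreeAlgebra.ι K 0, 0]

/-- The second of two commuting matrices acting on four copies of a `K⟨x, y⟩`-module. -/
def abelianSnd : Matrix (Fin 4) (Fin 4) (FreeAlg2 K) :=
  !![0, 0, 0, 0; 0, 0, 0, 0; 1, 0, 0, 0; 0, FreeAlgebra.ι K 0, FreeAlgebra.ι K 1, 0]

/-- Both products send the basis vector `0` to `x` times the basis vector `3` and kill the others.
-/
theorem abelianFst_comm :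
    abelianFst K * abelianSnd K - abelianSnd K * abelianFst K = (0 : K) • abelianSnd K := by
  rw [zero_smul, sub_eq_zero]
  ext i j
  fin_cases i <;> fin_cases j <;>
    simp [abelianFst, abelianSnd, Matrix.mul_apply, Fin.sum_univ_succ]

variable {K} {L : Type v} [LieRing L] [LieAlgebra K L] {α β : L →ₗ[K] K}

namespace IsPlaneQuotient

/-- The family of representations defined by the two commuting matrices. -/
def abelianFamily (h : IsPlaneQuotient 0 α β) : L →ₗ⁅K⁆ Matrix (Fin 4) (Fin 4) (FreeAlg2 K) :=
  h.toLieHom (abelianFst K) (abelianSnd K) (abelianFst_comm K)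

section

variable (h : IsPlaneQuotient 0 α β) {V : Type u} [AddCommGroup V] [Module K V]
  [Module (FreeAlg2 K) V] [IsScalarTower K (FreeAlg2 K) V]

local notation "E" => BimodTensor.single (abelianFamily h) (V := V)

theorem lie_abelianFamily_fst {a : L} (ha : α a = 1 ∧ β a = 0) (u : V) :
    ⁅a, E 0 u⁆ = E 1 u ∧ ⁅a, E 1 u⁆ = E 3 u ∧ ⁅a, E 2 u⁆ = E 3 (FreeAlgebra.ι K (0 : Fin 2) • u) ∧
      ⁅a, E 3 u⁆ = 0 := by
  have hA : abelianFamily h a = abelianFst K := by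
    simp [abelianFamily, toLieHom_apply, ha.1, ha.2]
  simp only [BimodTensor.lie_tmul, hA, Matrix.mulVec_single_one, ← BimodTensor.single_tmul]
  rw [← BimodTensor.zero_tmul (abelianFamily h) u]
  refine ⟨?_, ?_, ?_, ?_⟩ <;> congr 2 <;> funext i <;> fin_cases i <;>
    simp [abelianFst]

theorem lie_abelianFamily_snd {b : L} (hb : α b = 0 ∧ β b = 1) (u : V) :
    ⁅b, E 0 u⁆ = E 2 u ∧ ⁅b, E 1 u⁆ = E 3 (FreeAlgebra.ι K (0 : Fin 2) • u) ∧
      ⁅b, E 2 u⁆ = E 3 (FreeAlgebra.ι K (1 : Fin 2) • u) ∧ ⁅b, E 3 u⁆ = 0 := by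
  have hB : abelianFamily h b = abelianSnd K := by
    simp [abelianFamily, toLieHom_apply, hb.1, hb.2]
  simp only [BimodTensor.lie_tmul, hB, Matrix.mulVec_single_one, ← BimodTensor.single_tmul]
  rw [← BimodTensor.zero_tmul (abelianFamily h) u]
  refine ⟨?_, ?_, ?_, ?_⟩ <;> congr 2 <;> funext i <;> fin_cases i <;>
    simp [abelianSnd]

/-- The quadratic operators identify top and socle and recover the actions of `x` and `y` from the
action of `L`. -/
theorem lie_lie_abelianFamily {a b : L} (ha : α a = 1 ∧ β a = 0) (hb : α b = 0 ∧ β b = 1)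
    (v : BimodTensor (abelianFamily h) V) :
    ⁅a, ⁅a, v⁆⁆ = E 3 (BimodTensor.coord _ 0 v) ∧
      ⁅a, ⁅b, v⁆⁆ = E 3 (FreeAlgebra.ι K (0 : Fin 2) • BimodTensor.coord _ 0 v) ∧
      ⁅b, ⁅b, v⁆⁆ = E 3 (FreeAlgebra.ι K (1 : Fin 2) • BimodTensor.coord _ 0 v) := by
  induction v using BimodTensor.induction_on with
  | add v w hv hw => simp only [lie_add, map_add, smul_add, hv, hw, and_self]
  | zero => simp only [lie_zero, map_zero, smul_zero, and_self]
  | single p u =>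
    obtain ⟨a0, a1, a2, a3⟩ := lie_abelianFamily_fst h ha u
    obtain ⟨b0, b1, b2, b3⟩ := lie_abelianFamily_snd h hb u
    have ax := fun i => (lie_abelianFamily_fst h ha (FreeAlgebra.ι K (i : Fin 2) • u)).2.2.2
    have bx := fun i => (lie_abelianFamily_snd h hb (FreeAlgebra.ι K (i : Fin 2) • u)).2.2.2
    fin_cases p <;> simp_all

end

theorem isControlledWild_of_abelian (h : IsPlaneQuotient 0 α β) [IsAlgClosed K] [CharZero K]
    [LieAlgebra.IsSolvable L] : IsControlledWild K L := by
  obtain ⟨a, ha⟩ := h.exists_fst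
  obtain ⟨b, hb⟩ := h.exists_snd
  have hinj : ∀ {V : Type u} [AddCommGroup V] [Module K V] [Module (FreeAlg2 K) V]
      [IsScalarTower K (FreeAlg2 K) V] {u w : V},
      BimodTensor.single (abelianFamily h) 3 u =
        BimodTensor.single (abelianFamily h) 3 w → u = w := by
    intro V _ _ _ _ u w huw
    simpa using congrArg (BimodTensor.coord _ 3) huw
  refine isControlledWild_of_words (by norm_num) (abelianFamily h)
    {FreeAlgebra.ι K a * FreeAlgebra.ι K a} ?_ ?_ ?_
  · intro V W _ _ _ _ _ _ _ _ f
    let φ : V →ₗ[K] W := BimodTensor.coord (abelianFamily h) 0 ∘ₗ (f : _ →ₗ[K] _) ∘ₗ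
      BimodTensor.single (abelianFamily h) 0
    -- `f` commutes with `a²`, so on the socle it is its own top component.
    have hf : ∀ u, f (BimodTensor.single _ 3 u) =
        BimodTensor.single _ 3 (φ u) := fun u => by
      have := (lie_lie_abelianFamily h ha hb (BimodTensor.single _ 0 u)).1
      rw [BimodTensor.coord_tmul, Pi.single_eq_same, one_smul] at this
      rw [← this, LieModuleHom.map_lie, LieModuleHom.map_lie,
        (lie_lie_abelianFamily h ha hb _).1]
      rfl
    have hφ : ∀ (i : Fin 2) u, φ (FreeAlgebra.ι K i • u) = FreeAlgebra.ι K i • φ u := by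
      intro i u
      refine hinj ?_
      rw [← hf]
      have := (lie_lie_abelianFamily h ha hb (BimodTensor.single _ 0 u)).2
      rw [BimodTensor.coord_tmul, Pi.single_eq_same, one_smul] at this
      fin_cases i
      · refine (congrArg f this.1.symm).trans ?_
        rw [LieModuleHom.map_lie, LieModuleHom.map_lie, (lie_lie_abelianFamily h ha hb _).2.1]
        rfl
      · refine (congrArg f this.2.symm).trans ?_
        rw [LieModuleHom.map_lie, LieModuleHom.map_lie, (lie_lie_abelianFamily h ha hb _).2.2]
        rfl
    refine ⟨φ.toFreeAlg2 hφ, ?_⟩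
    rintro _ rfl v
    rw [← LieModuleHom.map_wordAction, ← LieModuleHom.map_wordAction]
    simp only [map_mul, Module.End.mul_apply, wordAction_ι, (lie_lie_abelianFamily h ha hb _).1]
    rw [hf]
    refine BimodTensor.ext_coord _ fun p => ?_
    rw [BimodTensor.coord_map, BimodTensor.coord_tmul, BimodTensor.coord_tmul, LinearMap.map_smul]
    rfl
  · intro V W _ _ _ _ _ _ _ _ φ hφ
    ext u
    refine hinj (V := W) ?_
    have := hφ _ rfl (BimodTensor.single _ 0 u)
    rw [map_mul, Module.End.mul_apply, wordAction_ι, wordAction_ι,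
      (lie_lie_abelianFamily h ha hb _).1, BimodTensor.coord_map] at this
    simpa using this
  · intro V _ _ _ _ ψ χ hψ v hv
    have hv := hv _ rfl
    rw [map_mul, Module.End.mul_apply, wordAction_ι, wordAction_ι,
      (lie_lie_abelianFamily h ha hb _).1] at hv
    have hv0 : BimodTensor.coord _ 0 v = 0 := hinj (hv.trans (map_zero _).symm)
    -- `a` is nilpotent on the chain `0 → 1 → 3`: either `χ a = 0`, or `ψ` vanishes along it.
    have h1 : ∀ u, ψ (BimodTensor.single _ 1 u) = 0 ∧
        ψ (BimodTensor.single _ 3 u) = 0 := fun u => by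
      obtain ⟨a0, a1, -, a3⟩ := lie_abelianFamily_fst h ha u
      have e0 := hψ a (BimodTensor.single _ 0 u)
      have e1 := hψ a (BimodTensor.single _ 1 u)
      have e3 := hψ a (BimodTensor.single _ 3 u)
      rw [a0] at e0
      rw [a1] at e1
      rw [a3, map_zero, zero_eq_mul] at e3
      rcases e3 with e3 | e3
      · rw [e3, zero_mul] at e0 e1
        exact ⟨e0, e1⟩
      · rw [e3, zero_eq_mul] at e1
        refine ⟨?_, e3⟩
        rcases e1 with e1 | e1
        · rw [e0, e1, zero_mul]
        · exact e1
    have h2 : ∀ u, ψ (BimodTensor.single _ 2 u) = 0 := fun u => by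
      obtain ⟨b0, -, b2, -⟩ := lie_abelianFamily_snd h hb u
      have e0 := hψ b (BimodTensor.single _ 0 u)
      have e2 := hψ b (BimodTensor.single _ 2 u)
      rw [b0] at e0
      rw [b2, (h1 _).2, zero_eq_mul] at e2
      rcases e2 with e2 | e2
      · rw [e0, e2, zero_mul]
      · exact e2
    rw [← BimodTensor.sum_single_coord _ v, Fin.sum_univ_four, hv0, map_add, map_add,
      map_add, (h1 _).1, (h1 _).2, h2, map_zero, map_zero, add_zero,
      add_zero, add_zero]

end IsPlaneQuotient

end Abelian

/-! ### The nonabelian quotient and the five-subspace configuration. -/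

section Affine

open Polynomial

/-- The index set of a basis of the bimodule over the nonabelian two-dimensional Lie algebra. The
index `(i, k, l)` stands for the vector obtained from the `i`-th generator by applying `k` times the
nilpotent part of `a` and `l` times `b`. -/
def affineIdx : Finset (ℕ × ℕ × ℕ) :=
  (Finset.range 5 ×ˢ Finset.range 5 ×ˢ Finset.range 5).filter fun p =>
    p.2.1 ≤ p.1 ∧ p.1 + p.2.2 ≤ 4 ∧ (p.2.1 = p.1 → p.1 + p.2.2 = 4 → p.1 ≤ 1)

theorem mem_affineIdx {i k l : ℕ} :
    (i, k, l) ∈ affineIdx ↔ k ≤ i ∧ i + l ≤ 4 ∧ (k = i → i + l = 4 → i ≤ 1) := by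
  simp only [affineIdx, Finset.mem_filter, Finset.mem_product, Finset.mem_range]
  omega

/-- The number of a basis vector. -/
noncomputable def affinePos (i k l : ℕ) (h : (i, k, l) ∈ affineIdx) : Fin affineIdx.card :=
  affineIdx.equivFin ⟨(i, k, l), h⟩

theorem affinePos_inj {i k l i' k' l' : ℕ} {h : (i, k, l) ∈ affineIdx}
    {h' : (i', k', l') ∈ affineIdx} :
    affinePos i k l h = affinePos i' k' l' h' ↔ i = i' ∧ k = k' ∧ l = l' := by
  simp [affinePos]

theorem exists_affinePos (p : Fin affineIdx.card) : ∃ i k l h, p = affinePos i k l h := by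
  obtain ⟨⟨⟨i, k, l⟩, h⟩, rfl⟩ := affineIdx.equivFin.surjective p
  exact ⟨i, k, l, h, rfl⟩

/-- The position of the `i`-th generator. -/
noncomputable def affineGen (i : Fin 5) : Fin affineIdx.card :=
  affinePos i 0 0 (mem_affineIdx.2 (by omega))

/-- The position of the first of the two basis vectors of the socle. -/
noncomputable def affineSocFst : Fin affineIdx.card := affinePos 0 0 4 (by decide)

/-- The position of the second of the two basis vectors of the socle. -/
noncomputable def affineSocSnd : Fin affineIdx.card := affinePos 1 1 3 (by decide)

theorem affineSocFst_ne_snd : affineSocFst ≠ affineSocSnd := by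
  simp [affineSocFst, affineSocSnd, affinePos_inj]

variable (K : Type u) [Field K]

/-- The first coordinate of the vector of the socle under the `i`-th generator. -/
def affineCoeffFst (i : ℕ) : FreeAlg2 K := if i = 1 then 0 else 1

/-- The second coordinate of the vector of the socle under the `i`-th generator. -/
def affineCoeffSnd (i : ℕ) : FreeAlg2 K :=
  if i = 0 then 0 else if i = 3 then FreeAlgebra.ι K 0 else if i = 4 then FreeAlgebra.ι K 1 else 1

open scoped Classical in
/-- The vector obtained from the `i`-th generator by applying `k` times the nilpotent part of `a`
and `l` times `b`. -/
noncomputable def affineCol (i k l : ℕ) : Fin affineIdx.card → FreeAlg2 K :=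
  if k = i ∧ i + l = 4 then
    Pi.single affineSocFst (affineCoeffFst K i) + Pi.single affineSocSnd (affineCoeffSnd K i)
  else if h : (i, k, l) ∈ affineIdx then Pi.single (affinePos i k l h) 1 else 0

variable {K}

theorem affineCol_corner {i l : ℕ} (h : i + l = 4) : affineCol K i i l =
    Pi.single affineSocFst (affineCoeffFst K i) + Pi.single affineSocSnd (affineCoeffSnd K i) := by
  rw [affineCol, if_pos ⟨rfl, h⟩]

theorem affineCol_eq_zero {i k l : ℕ} (h : i < k ∨ 4 < i + l) : affineCol K i k l = 0 := by
  rw [affineCol, if_neg (by omega), dif_neg (by rw [mem_affineIdx]; omega)]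

/-- The corners of generators `0` and `1` are kept as basis vectors, and their coefficient pairs
`(1, 0)` and `(0, 1)` give these vectors back. -/
theorem affineCol_of_mem {i k l : ℕ} (h : (i, k, l) ∈ affineIdx) :
    affineCol K i k l = Pi.single (affinePos i k l h) 1 := by
  by_cases hc : k = i ∧ i + l = 4
  · obtain ⟨rfl, hl⟩ := hc
    rw [affineCol_corner hl]
    obtain rfl | rfl : k = 0 ∨ k = 1 := by
      rw [mem_affineIdx] at h
      omega
    · obtain rfl : l = 4 := by omega
      simp [affineCoeffFst, affineCoeffSnd, affineSocFst]
    · obtain rfl : l = 3 := by omega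
      simp [affineCoeffFst, affineCoeffSnd, affineSocSnd]
  · rw [affineCol, if_neg hc, dif_pos h]

theorem affineCol_cases (i k l : ℕ) : (i < k ∨ 4 < i + l) ∨ (i, k, l) ∈ affineIdx ∨
    (k = i ∧ i + l = 4) := by
  rw [mem_affineIdx]
  omega

variable (K)

/-- The matrix of the semisimple-by-nilpotent basis element. -/
noncomputable def affineFst : Matrix (Fin affineIdx.card) (Fin affineIdx.card) (FreeAlg2 K) :=
  Matrix.of fun r s =>
    let p := (affineIdx.equivFin.symm s).1
    (((p.1 + p.2.2 : ℕ) : K) • Pi.single (M := fun _ => FreeAlg2 K) s 1 +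
      affineCol K p.1 (p.2.1 + 1) p.2.2 :
      Fin affineIdx.card → FreeAlg2 K) r

/-- The matrix of the nilpotent basis element. -/
noncomputable def affineSnd : Matrix (Fin affineIdx.card) (Fin affineIdx.card) (FreeAlg2 K) :=
  Matrix.of fun r s =>
    let p := (affineIdx.equivFin.symm s).1
    affineCol K p.1 p.2.1 (p.2.2 + 1) r

theorem affineFst_col {i k l : ℕ} (h : (i, k, l) ∈ affineIdx) :
    (affineFst K).col (affinePos i k l h) =
      ((i + l : ℕ) : K) • Pi.single (M := fun _ => FreeAlg2 K) (affinePos i k l h) 1 +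
        affineCol K i (k + 1) l := by
  funext r
  simp [Matrix.col, affineFst, affinePos]

theorem affineSnd_col {i k l : ℕ} (h : (i, k, l) ∈ affineIdx) :
    (affineSnd K).col (affinePos i k l h) = affineCol K i k (l + 1) := by
  funext r
  simp [Matrix.col, affineSnd, affinePos]

/-- The formula survives the identification of corners because all of them have weight `4` and are
killed by the shift in `k`. -/
theorem affineFst_mulVec (i k l : ℕ) : (affineFst K).mulVec (affineCol K i k l) =
    ((i + l : ℕ) : K) • affineCol K i k l + affineCol K i (k + 1) l := by
  rcases affineCol_cases i k l with h | h | ⟨rfl, h⟩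
  · rw [affineCol_eq_zero h, affineCol_eq_zero (by omega), Matrix.mulVec_zero, smul_zero, add_zero]
  · rw [affineCol_of_mem h, Matrix.mulVec_single_one, affineFst_col]
  · rw [affineCol_corner h, affineCol_eq_zero (by omega), add_zero, Matrix.mulVec_add,
      Matrix.mulVec_single, Matrix.mulVec_single, affineSocFst, affineSocSnd, affineFst_col,
      affineFst_col, affineCol_eq_zero (by omega), affineCol_eq_zero (by omega), h, smul_add]
    funext r
    simp [Pi.single_apply]

theorem affineSnd_mulVec (i k l : ℕ) :
    (affineSnd K).mulVec (affineCol K i k l) = affineCol K i k (l + 1) := by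
  rcases affineCol_cases i k l with h | h | ⟨rfl, h⟩
  · rw [affineCol_eq_zero h, affineCol_eq_zero (by omega), Matrix.mulVec_zero]
  · rw [affineCol_of_mem h, Matrix.mulVec_single_one, affineSnd_col]
  · rw [affineCol_corner h, affineCol_eq_zero (by omega), Matrix.mulVec_add,
      Matrix.mulVec_single, Matrix.mulVec_single, affineSocFst, affineSocSnd, affineSnd_col,
      affineSnd_col, affineCol_eq_zero (by omega), affineCol_eq_zero (by omega)]
    simp

/-- The two shifts commute, and `b` raises the weight `i + l` by one. -/
theorem affineFst_comm :
    affineFst K * affineSnd K - affineSnd K * affineFst K = (1 : K) • affineSnd K := by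
  refine Matrix.ext_of_mulVec_single fun p => ?_
  obtain ⟨i, k, l, h, rfl⟩ := exists_affinePos p
  rw [← affineCol_of_mem h, one_smul, Matrix.sub_mulVec, ← Matrix.mulVec_mulVec,
    ← Matrix.mulVec_mulVec, affineSnd_mulVec, affineFst_mulVec, affineFst_mulVec, Matrix.mulVec_add,
    Matrix.mulVec_smul, affineSnd_mulVec, affineSnd_mulVec]
  push_cast
  module

variable {K : Type u} [Field K] {L : Type v} [LieRing L] [LieAlgebra K L] {α β : L →ₗ[K] K}

variable (K) in
/-- A polynomial in `a` which annihilates the vectors of weight less than `4`. -/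
noncomputable def affineKill : K[X] := ∏ j ∈ Finset.range 4, (X - C (j : K)) ^ 5

theorem affineKill_eval_ne_zero [CharZero K] : (affineKill K).eval 4 ≠ 0 := by
  rw [affineKill, eval_prod, Finset.prod_ne_zero_iff]
  intro j hj
  rw [Finset.mem_range] at hj
  simp only [eval_pow, eval_sub, eval_X, eval_C]
  refine pow_ne_zero _ (sub_ne_zero.2 ?_)
  exact_mod_cast (by omega : (4 : ℕ) ≠ j)

/-- A noncommutative polynomial which takes the `i`-th generator to the socle and annihilates the
other basis vectors. -/
noncomputable def affineWord (a b : L) (i : Fin 5) : FreeAlgebra K L :=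
  aeval (FreeAlgebra.ι K a) ((X - C 4) ^ (i : ℕ) * affineKill K) *
    FreeAlgebra.ι K b ^ (4 - (i : ℕ))

namespace IsPlaneQuotient

/-- The family of representations which factor through the nonabelian two-dimensional algebra. -/
noncomputable def affineFamily (h : IsPlaneQuotient 1 α β) :
    L →ₗ⁅K⁆ Matrix (Fin affineIdx.card) (Fin affineIdx.card) (FreeAlg2 K) :=
  h.toLieHom (affineFst K) (affineSnd K) (affineFst_comm K)

section

variable (h : IsPlaneQuotient 1 α β) {V : Type u} [AddCommGroup V] [Module K V]
  [Module (FreeAlg2 K) V] [IsScalarTower K (FreeAlg2 K) V]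

/-- The vector obtained from the `i`-th generator by applying `k` times the nilpotent part of `a`
and `l` times `b`. -/
noncomputable def affineVec (i k l : ℕ) : V →ₗ[K] BimodTensor (affineFamily h) V :=
  BimodTensor.tmul (affineFamily h) (affineCol K i k l)

theorem affineVec_eq_zero {i k l : ℕ} (hi : i < k ∨ 4 < i + l) (u : V) :
    affineVec h i k l u = 0 := by
  rw [affineVec, affineCol_eq_zero hi, BimodTensor.zero_tmul]

theorem affineVec_of_mem {i k l : ℕ} (hi : (i, k, l) ∈ affineIdx) :
    affineVec h i k l = BimodTensor.single (affineFamily h) (affinePos i k l hi) (V := V) := by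
  rw [affineVec, affineCol_of_mem hi]

theorem affineVec_corner {i l : ℕ} (hi : i + l = 4) (u : V) : affineVec h i i l u =
    BimodTensor.single (affineFamily h) affineSocFst (affineCoeffFst K i • u) +
      BimodTensor.single (affineFamily h) affineSocSnd (affineCoeffSnd K i • u) := by
  rw [affineVec, affineCol_corner hi, BimodTensor.add_tmul, BimodTensor.single_tmul,
    BimodTensor.single_tmul (p := affineSocSnd)]

theorem lie_affineVec_fst {a : L} (ha : α a = 1 ∧ β a = 0) (i k l : ℕ) (u : V) :
    ⁅a, affineVec h i k l u⁆ =
      ((i + l : ℕ) : K) • affineVec h i k l u + affineVec h i (k + 1) l u := by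
  have hA : affineFamily h a = affineFst K := by
    simp [affineFamily, toLieHom_apply, ha.1, ha.2]
  simp only [affineVec]
  rw [BimodTensor.lie_tmul, hA, affineFst_mulVec, BimodTensor.add_tmul, BimodTensor.smul_tmul]

theorem lie_affineVec_snd {b : L} (hb : α b = 0 ∧ β b = 1) (i k l : ℕ) (u : V) :
    ⁅b, affineVec h i k l u⁆ = affineVec h i k (l + 1) u := by
  have hB : affineFamily h b = affineSnd K := by
    simp [affineFamily, toLieHom_apply, hb.1, hb.2]
  simp only [affineVec]
  rw [BimodTensor.lie_tmul, hB, affineSnd_mulVec]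

theorem pow_toEnd_affineVec {b : L} (hb : α b = 0 ∧ β b = 1) (i k l m : ℕ) (u : V) :
    (LieModule.toEnd K L (BimodTensor (affineFamily h) V) b ^ m) (affineVec h i k l u) =
      affineVec h i k (l + m) u := by
  induction m generalizing l with
  | zero => rfl
  | succ m ih =>
    rw [pow_succ, Module.End.mul_apply, LieModule.toEnd_apply_apply, lie_affineVec_snd h hb, ih,
      add_right_comm, add_assoc]

theorem aeval_toEnd_affineVec {a : L} (ha : α a = 1 ∧ β a = 0) {i l d : ℕ} (hd : i + l = d)
    (k m : ℕ) (u : V) :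
    aeval (LieModule.toEnd K L (BimodTensor (affineFamily h) V) a) ((X - C (d : K)) ^ m)
      (affineVec h i k l u) = affineVec h i (k + m) l u := by
  subst hd
  induction m generalizing k with
  | zero => simp
  | succ m ih =>
    rw [pow_succ, map_mul, Module.End.mul_apply, map_sub, aeval_X, aeval_C, LinearMap.sub_apply,
      Module.algebraMap_end_apply, LieModule.toEnd_apply_apply, lie_affineVec_fst h ha,
      add_sub_cancel_left, ih, add_right_comm, add_assoc]

/-- The factor for the weight `i + l` shifts `k` by `5`, beyond its bound `i`. -/
theorem aeval_affineKill_affineVec {a : L} (ha : α a = 1 ∧ β a = 0) {i l : ℕ} (hil : i + l < 4)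
    (k : ℕ) (u : V) :
    aeval (LieModule.toEnd K L (BimodTensor (affineFamily h) V) a) (affineKill K)
      (affineVec h i k l u) = 0 := by
  obtain ⟨q, hq⟩ := Finset.dvd_prod_of_mem (fun j : ℕ => (X - C (j : K)) ^ 5)
    (Finset.mem_range.2 hil)
  rw [affineKill, hq, mul_comm, map_mul, Module.End.mul_apply, aeval_toEnd_affineVec h ha rfl,
    affineVec_eq_zero h (by omega), map_zero]

theorem wordAction_affineWord_apply {M : Type*} [AddCommGroup M] [Module K M] [LieRingModule L M]
    [LieModule K L M] (a b : L) (i : Fin 5) (m : M) :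
    wordAction K L M (affineWord a b i) m =
      aeval (LieModule.toEnd K L M a) ((X - C 4) ^ (i : ℕ) * affineKill K)
        ((LieModule.toEnd K L M b ^ (4 - (i : ℕ))) m) := by
  have hι : ∀ z : L, wordAction K L M (FreeAlgebra.ι K z) = LieModule.toEnd K L M z := fun z => by
    simp [wordAction]
  rw [affineWord, map_mul, Module.End.mul_apply, map_pow, ← Polynomial.aeval_algHom_apply, hι, hι]

/-- After `b ^ (4 - i)`, lower weights are killed by `affineKill` and higher ones are zero. In
weight `4` one has `j + l = i`, and `(a - 4) ^ i` shifts `k` by `i`, which is too far unless `j = i`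
and `k = l = 0`. What survives is an eigenvector of `a`, on which `affineKill` is a nonzero scalar.
-/
theorem wordAction_affineWord_affineVec {a b : L} (ha : α a = 1 ∧ β a = 0)
    (hb : α b = 0 ∧ β b = 1) (i : Fin 5) (j k l : ℕ) (u : V) :
    wordAction K L (BimodTensor (affineFamily h) V) (affineWord a b i) (affineVec h j k l u) =
      if j = i ∧ k = 0 ∧ l = 0 then (affineKill K).eval 4 • affineVec h i i (4 - i) u else 0 := by
  rw [wordAction_affineWord_apply, pow_toEnd_affineVec h hb]
  rcases lt_trichotomy (j + (l + (4 - (i : ℕ)))) 4 with hlt | heq | hgt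
  · rw [map_mul, Module.End.mul_apply, aeval_affineKill_affineVec h ha hlt, map_zero,
      if_neg (by omega)]
  · rw [mul_comm, map_mul, Module.End.mul_apply]
    have := aeval_toEnd_affineVec h ha heq k i u
    rw [Nat.cast_ofNat] at this
    rw [this]
    split_ifs with hc
    · obtain ⟨rfl, rfl, rfl⟩ := hc
      rw [Nat.zero_add, Nat.zero_add]
      refine Module.End.aeval_apply_of_mem_apply_eq_smul ?_
      rw [LieModule.toEnd_apply_apply, lie_affineVec_fst h ha,
        affineVec_eq_zero h (Or.inl (Nat.lt_succ_self _)),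
        add_zero, show (i : ℕ) + (4 - i) = 4 by omega, Nat.cast_ofNat]
    · rw [affineVec_eq_zero h (by omega), map_zero]
  · rw [affineVec_eq_zero h (Or.inr hgt), map_zero, if_neg (by omega)]

theorem wordAction_affineWord {a b : L} (ha : α a = 1 ∧ β a = 0) (hb : α b = 0 ∧ β b = 1)
    (i : Fin 5) (v : BimodTensor (affineFamily h) V) :
    wordAction K L (BimodTensor (affineFamily h) V) (affineWord a b i) v =
      (affineKill K).eval 4 • affineVec h i i (4 - i) (BimodTensor.coord _ (affineGen i) v) := by
  induction v using BimodTensor.induction_on with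
  | add v w hv hw => simp only [map_add, smul_add, hv, hw]
  | zero => simp only [map_zero, smul_zero]
  | single p u =>
    obtain ⟨j, k, l, hp, rfl⟩ := exists_affinePos p
    have := wordAction_affineWord_affineVec h ha hb i j k l u
    rw [affineVec_of_mem h hp] at this
    rw [this, BimodTensor.coord_tmul, affineGen, Pi.single_apply]
    simp only [affinePos_inj]
    by_cases hc : j = i ∧ k = 0 ∧ l = 0
    · obtain ⟨rfl, rfl, rfl⟩ := hc
      simp
    · rw [if_neg hc, if_neg (by omega), zero_smul, map_zero, smul_zero]

theorem single_socle_injective {u w u' w' : V}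
    (huw : BimodTensor.single (affineFamily h) affineSocFst u +
        BimodTensor.single (affineFamily h) affineSocSnd w =
      BimodTensor.single (affineFamily h) affineSocFst u' +
        BimodTensor.single (affineFamily h) affineSocSnd w') : u = u' ∧ w = w' := by
  have h1 := congrArg (BimodTensor.coord _ affineSocFst) huw
  have h2 := congrArg (BimodTensor.coord _ affineSocSnd) huw
  simp only [map_add, BimodTensor.coord_tmul, Pi.single_eq_same, one_smul,
    Pi.single_eq_of_ne affineSocFst_ne_snd, Pi.single_eq_of_ne affineSocFst_ne_snd.symm, zero_smul,
    add_zero, zero_add] at h1 h2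
  exact ⟨h1, h2⟩

/-- One of the two socle coefficients is always `1`. -/
theorem affineVec_corner_injective (i : Fin 5) :
    Function.Injective (affineVec h i i (4 - i) : V → BimodTensor (affineFamily h) V) := by
  intro u w huw
  rw [affineVec_corner h (by omega), affineVec_corner h (by omega)] at huw
  have := single_socle_injective h huw
  fin_cases i <;> simp_all [affineCoeffFst, affineCoeffSnd]

/-- A functional spanning a one-dimensional quotient representation vanishes on the radical. -/
theorem apply_affineVec_eq_zero {a b : L} (ha : α a = 1 ∧ β a = 0) (hb : α b = 0 ∧ β b = 1)
    {ψ : BimodTensor (affineFamily h) V →ₗ[K] K} {χ : L → K} (hψ : ∀ z v, ψ ⁅z, v⁆ = χ z * ψ v)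
    {i k l : ℕ} (hkl : k ≠ 0 ∨ l ≠ 0) (u : V) : ψ (affineVec h i k l u) = 0 := by
  by_cases hl : l = 0
  · subst hl
    have hk := hkl.resolve_right (by simp)
    -- The shift `a - i` acts under `ψ` as `χ a - i`; being nilpotent, it forces `χ a = i` or `ψ =
    -- 0` on the generator.
    have step : ∀ m, ψ (affineVec h i m 0 u) = (χ a - i) ^ m * ψ (affineVec h i 0 0 u) := by
      intro m
      induction m with
      | zero => simp
      | succ m ih =>
        have := hψ a (affineVec h i m 0 u)
        rw [lie_affineVec_fst h ha, map_add, map_smul, smul_eq_mul, add_zero] at this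
        rw [pow_succ', mul_assoc, ← ih]
        linear_combination this
    have hzero := step (i + 1)
    rw [affineVec_eq_zero h (Or.inl (Nat.lt_succ_self i)), map_zero, zero_eq_mul] at hzero
    rw [step k]
    rcases hzero with hz | hz
    · rw [pow_eq_zero_iff (Nat.succ_ne_zero i)] at hz
      rw [hz, zero_pow hk, zero_mul]
    · rw [hz, mul_zero]
  · obtain ⟨l, rfl⟩ := Nat.exists_eq_succ_of_ne_zero hl
    -- `⁅a, b⁆` acts on the family as `b` does, and semi-invariants vanish on the image of a
    -- commutator.
    have hab : α ⁅a, b⁆ = 0 ∧ β ⁅a, b⁆ = 1 :=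
      ⟨h.fst_lie a b, by rw [h.snd_lie, ha.1, ha.2, hb.1, hb.2]; ring⟩
    rw [Nat.succ_eq_add_one, ← lie_affineVec_snd h hab, lie_lie, map_sub, hψ, hψ, hψ, hψ]
    ring

end

theorem isControlledWild_of_affine [IsAlgClosed K] [CharZero K] [LieAlgebra.IsSolvable L]
    (h : IsPlaneQuotient 1 α β) : IsControlledWild K L := by
  obtain ⟨a, ha⟩ := h.exists_fst
  obtain ⟨b, hb⟩ := h.exists_snd
  refine isControlledWild_of_words (Finset.card_pos.2 ⟨(0, 0, 0), by decide⟩) (affineFamily h)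
    (Set.range (affineWord a b)) ?_ ?_ ?_
  · intro V W _ _ _ _ _ _ _ _ f
    let φ : Fin 5 → V →ₗ[K] W := fun i => BimodTensor.coord (affineFamily h) (affineGen i) ∘ₗ
      (f : _ →ₗ[K] _) ∘ₗ BimodTensor.single (affineFamily h) (affineGen i)
    have hf : ∀ (i : Fin 5) u, f (affineVec h i i (4 - i) u) = affineVec h i i (4 - i) (φ i u) := by
      intro i u
      have h1 := wordAction_affineWord h ha hb i (BimodTensor.single _ (affineGen i) u)
      have h2 := wordAction_affineWord h ha hb i (f (BimodTensor.single _ (affineGen i) u))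
      rw [← LieModuleHom.map_wordAction, h1, map_smul, BimodTensor.coord_tmul, Pi.single_eq_same,
        one_smul] at h2
      exact smul_right_injective _ affineKill_eval_ne_zero h2
    have hfst : ∀ u, f (BimodTensor.single _ affineSocFst u) =
        BimodTensor.single _ affineSocFst (φ 0 u) := fun u => by
      simpa [affineVec_corner, affineCoeffFst, affineCoeffSnd] using hf 0 u
    have hsnd : ∀ u, f (BimodTensor.single _ affineSocSnd u) =
        BimodTensor.single _ affineSocSnd (φ 1 u) := fun u => by
      simpa [affineVec_corner, affineCoeffFst, affineCoeffSnd] using hf 1 u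
    -- On the socle `f` is `φ 0 ⊕ φ 1`, and it must map the `i`-th of the five subspaces by `φ i`.
    have hcorner : ∀ (i : Fin 5) u, φ 0 (affineCoeffFst K i • u) = affineCoeffFst K i • φ i u ∧
        φ 1 (affineCoeffSnd K i • u) = affineCoeffSnd K i • φ i u := fun i u => by
      have := hf i u
      rw [affineVec_corner h (by omega), affineVec_corner h (by omega), map_add, hfst, hsnd] at this
      exact single_socle_injective h this
    -- Generator `2` spans the diagonal; generators `3` and `4` below give the graphs of `x` and
    -- `y`.
    have h1 : ∀ u, φ 1 u = φ 0 u := fun u => by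
      have := hcorner 2 u
      simp [affineCoeffFst, affineCoeffSnd] at this
      rw [this.1, this.2]
    have hφ : ∀ (i : Fin 5) u, φ i u = φ 0 u := fun i u => by
      by_cases hi : i = 1
      · rw [hi, h1]
      · have := (hcorner i u).1
        have hi' : (i : ℕ) ≠ 1 := fun hi' => hi (Fin.ext hi')
        rw [affineCoeffFst, if_neg hi', one_smul, one_smul] at this
        exact this.symm
    have hlin : ∀ (i : Fin 2) u, φ 0 (FreeAlgebra.ι K i • u) = FreeAlgebra.ι K i • φ 0 u := by
      intro i u
      rw [← h1]
      fin_cases i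
      · simpa [affineCoeffSnd, hφ 3] using (hcorner 3 u).2
      · simpa [affineCoeffSnd, hφ 4] using (hcorner 4 u).2
    refine ⟨(φ 0).toFreeAlg2 hlin, ?_⟩
    rintro _ ⟨i, rfl⟩ v
    rw [← LieModuleHom.map_wordAction, wordAction_affineWord h ha hb, map_smul, hf, hφ,
      wordAction_affineWord h ha hb, BimodTensor.coord_map]
    rfl
  · intro V W _ _ _ _ _ _ _ _ φ hφ
    ext u
    have := hφ _ ⟨0, rfl⟩ (BimodTensor.single _ (affineGen 0) u)
    rw [wordAction_affineWord h ha hb, smul_eq_zero_iff_right affineKill_eval_ne_zero,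
      BimodTensor.coord_map, BimodTensor.coord_tmul, Pi.single_eq_same, one_smul] at this
    exact affineVec_corner_injective h 0 (this.trans (map_zero _).symm)
  · intro V _ _ _ _ ψ χ hψ v hv
    have hgen : ∀ i, BimodTensor.coord _ (affineGen i) v = 0 := fun i => by
      have := hv _ ⟨i, rfl⟩
      rw [wordAction_affineWord h ha hb, smul_eq_zero_iff_right affineKill_eval_ne_zero] at this
      exact affineVec_corner_injective h i (this.trans (map_zero _).symm)
    rw [← BimodTensor.sum_single_coord _ v, map_sum]
    refine Finset.sum_eq_zero fun p _ => ?_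
    obtain ⟨i, k, l, hp, rfl⟩ := exists_affinePos p
    by_cases hkl : k ≠ 0 ∨ l ≠ 0
    · rw [← affineVec_of_mem h hp]
      exact apply_affineVec_eq_zero h ha hb hψ hkl _
    · obtain ⟨rfl, rfl⟩ : k = 0 ∧ l = 0 := by omega
      have hi : i < 5 := by
        rw [mem_affineIdx] at hp
        omega
      have := hgen ⟨i, hi⟩
      rw [affineGen] at this
      rw [this, map_zero, map_zero]

end IsPlaneQuotient

end Affine

theorem mainTheorem3 (K : Type u) [Field K] [IsAlgClosed K] [CharZero K]
    (L : Type v) [LieRing L] [LieAlgebra K L] [FiniteDimensional K L]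
    (hsolv : LieAlgebra.IsSolvable L) (hdim : 1 < Module.finrank K L) :
    IsControlledWild K L := by
  obtain ⟨α, β, h | h⟩ := exists_isPlaneQuotient (K := K) (L := L) hdim
  · exact h.isControlledWild_of_abelian
  · exact h.isControlledWild_of_affine
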